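/- Let $M$ be an oriented $n$-dimensional manifold of class $C^1$ (without boundary, given by a fixed $C^1$ atlas). Let $\mathrm{Met}(M)$ be the set of all locally Lipschitz-$C^1$ Riemannian metrics on $M$, i.e. the Riemannian metrics whose coefficients in every chart of the atlas are of class $C^1$ with locally Lipschitz continuous first derivatives. Equip $\mathrm{Met}(M)$ with the compact-open $C^1$-topology, generated by the sets of all $g\in\mathrm{Met}(M)$ whose coefficients and their first derivatives in a given chart of the atlas are $\varepsilon$-close to those of a given $f\in\mathrm{Met}(M)$ on a given compact subset of the domain of the chart, $\varepsilon>0$. For $x\in M$ and $h\in\mathrm{Met}(M)$, let $\mathrm{Hol}_x(h)\subseteq\mathrm{GL}(T_xM)$ be the holonomy group of the Levi-Civita connection of $h$, i.e. the set of parallel transports along all piecewise $C^1$ loops based at $x$; here a vector field along a path is parallel if its components in charts of the atlas satisfy $\dot s^k+\sum_{i,j}\Gamma^k_{ij}\,\dot c^i s^j=0$ with the Christoffel symbols of $h$, piecewise along a subdivision of the path into $C^1$ pieces each contained in a chart domain. For a subgroup $H\subseteq\mathrm{SO}(n)$ we say that $\mathrm{Hol}_x(h)\subseteq H$ up to conjugation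 if, after identifying $T_xM$ with $\mathbb R^n$ by a positively oriented $h$-orthonormal basis, there is $U\in\mathrm{SO}(n)$ with $U\,\mathrm{Hol}_x(h)\,U^{-1}\subseteq H$. Then for every closed subgroup $H\subseteq\mathrm{SO}(n)$ and every $x\in M$, the set $$\{h\in\mathrm{Met}(M)\mid \mathrm{Hol}_x(h)\subseteq H\text{ up to conjugation}\}$$ is closed in $\mathrm{Met}(M)$. -/

import Mathlib

open Set
open scoped Manifold Topology

noncomputable section

section Metrics

variable {n : ℕ} {M : Type*} [TopologicalSpace M] [ChartedSpace (EuclideanSpace ℝ (Fin n)) M]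

/-- The coefficient `h_{ij} = h(∂_i, ∂_j)` of a Riemannian metric in a chart `e`, as a function of
the coordinates `u`. -/
def metricCoeff (h : Bundle.RiemannianMetric (fun p : M ↦ TangentSpace (𝓡 n) p))
    (e : OpenPartialHomeomorph M (EuclideanSpace ℝ (Fin n))) (i j : Fin n)
    (u : EuclideanSpace ℝ (Fin n)) : ℝ :=
  h.inner (e.symm u)
    (mfderiv (𝓡 n) (𝓡 n) e.symm u (EuclideanSpace.single i 1 : EuclideanSpace ℝ (Fin n)))
    (mfderiv (𝓡 n) (𝓡 n) e.symm u (EuclideanSpace.single j 1 : EuclideanSpace ℝ (Fin n)))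

variable (n M) in
/-- The set `Met(M)` of locally Lipschitz-`C^1` Riemannian metrics: in every chart of the atlas
the coefficients are of class `C^1` with locally Lipschitz continuous derivative. -/
structure Met extends Bundle.RiemannianMetric (fun p : M ↦ TangentSpace (𝓡 n) p) where
  contDiffOn_coeff : ∀ e ∈ atlas (EuclideanSpace ℝ (Fin n)) M, ∀ i j : Fin n,
    ContDiffOn ℝ 1 (metricCoeff toRiemannianMetric e i j) e.target
  locallyLipschitzOn_fderiv_coeff : ∀ e ∈ atlas (EuclideanSpace ℝ (Fin n)) M, ∀ i j : Fin n,
    LocallyLipschitzOn e.target (fderiv ℝ (metricCoeff toRiemannianMetric e i j))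

/-- The coefficients `h_{ij}` of a metric in the chart `e`. -/
def Met.coeff (h : Met n M) (e : OpenPartialHomeomorph M (EuclideanSpace ℝ (Fin n)))
    (i j : Fin n) : EuclideanSpace ℝ (Fin n) → ℝ :=
  metricCoeff h.toRiemannianMetric e i j

/-- The basic set of the compact-open `C^1`-topology: the metrics that are, together with their
first derivatives, `ε`-close to `f` on the compact set `K` in the coordinates of the chart `e`. -/
def Met.basicNhd (f : Met n M) (e : OpenPartialHomeomorph M (EuclideanSpace ℝ (Fin n)))
    (K : Set M) (ε : ℝ) : Set (Met n M) :=
  {g | ∀ p ∈ K, ∀ i j : Fin n, |g.coeff e i j (e p) - f.coeff e i j (e p)| < ε ∧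
    ‖fderiv ℝ (g.coeff e i j) (e p) - fderiv ℝ (f.coeff e i j) (e p)‖ < ε}

/-- The compact-open `C^1`-topology on `Met(M)`. -/
instance Met.instTopologicalSpace : TopologicalSpace (Met n M) :=
  TopologicalSpace.generateFrom
    {B | ∃ (f : Met n M) (e : OpenPartialHomeomorph M (EuclideanSpace ℝ (Fin n))) (K : Set M)
      (ε : ℝ), e ∈ atlas (EuclideanSpace ℝ (Fin n)) M ∧ IsCompact K ∧ K ⊆ e.source ∧ 0 < ε ∧
        B = f.basicNhd e K ε}

/-- The Christoffel symbol `Γ^k_{ij}` of the Levi-Civita connection of `h` in the chart `e`: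
`Γ^k_{ij} = 1/2 ∑_l h^{kl} (∂_i h_{jl} + ∂_j h_{il} - ∂_l h_{ij})`. -/
def Met.christoffel (h : Met n M) (e : OpenPartialHomeomorph M (EuclideanSpace ℝ (Fin n)))
    (k i j : Fin n) (u : EuclideanSpace ℝ (Fin n)) : ℝ :=
  (1 / 2 : ℝ) * ∑ l : Fin n, (Matrix.of fun a b : Fin n ↦ h.coeff e a b u)⁻¹ k l *
    (fderiv ℝ (h.coeff e j l) u (EuclideanSpace.single i 1)
      + fderiv ℝ (h.coeff e i l) u (EuclideanSpace.single j 1)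
      - fderiv ℝ (h.coeff e i j) u (EuclideanSpace.single l 1))

end Metrics

section Holonomy

variable (n : ℕ) {M : Type*} [TopologicalSpace M] [ChartedSpace (EuclideanSpace ℝ (Fin n)) M]

/-- A path is piecewise differentiable if `[0,1]` has a subdivision `0 = t_0 < ⋯ < t_m = 1` such
that the path is of class `C^1` on every closed interval `[t_i, t_{i+1}]`. -/
def IsPiecewiseC1 {x y : M} (c : Path x y) : Prop :=
  ∃ (m : ℕ) (t : ℕ → ℝ), t 0 = 0 ∧ t m = 1 ∧ (∀ i < m, t i < t (i + 1)) ∧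
    ∀ i < m, ContMDiffOn 𝓘(ℝ, ℝ) (𝓡 n) 1 c.extend (Icc (t i) (t (i + 1)))

/-- A subdivision `0 = t_0 < ⋯ < t_m = 1` of `[0,1]` together with charts of the atlas, such that
on `[t_i, t_{i+1}]` the path is of class `C^1` and runs inside the `i`-th chart. Every piecewise
differentiable path has one. -/
structure ChartSubdivision {x y : M} (c : Path x y) where
  m : ℕ
  t : ℕ → ℝ
  t_zero : t 0 = 0
  t_last : t m = 1
  t_lt : ∀ i < m, t i < t (i + 1)
  chart : ℕ → OpenPartialHomeomorph M (EuclideanSpace ℝ (Fin n))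
  chart_mem : ∀ i < m, chart i ∈ atlas (EuclideanSpace ℝ (Fin n)) M
  mapsTo : ∀ i < m, MapsTo c.extend (Icc (t i) (t (i + 1))) (chart i).source
  contMDiffOn : ∀ i < m, ContMDiffOn 𝓘(ℝ, ℝ) (𝓡 n) 1 c.extend (Icc (t i) (t (i + 1)))

variable {n}

/-- A vector field `s` along the path `c` is parallel for the Levi-Civita connection of `h`: on
each interval `[t_i, t_{i+1}]`, with `u` the coordinates of `c` and `σ` the components of `s` in the
`i`-th chart, `σ_k' + ∑_{a,b} Γ^k_{ab}(u) u_a' σ_b = 0` for all `k`. -/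
def IsParallel (h : Met n M) {x y : M} (c : Path x y) (S : ChartSubdivision n c)
    (s : ℝ → TangentBundle (𝓡 n) M) : Prop :=
  (∀ t ∈ Icc (0 : ℝ) 1, (s t).proj = c.extend t) ∧
  ∀ i < S.m,
    let J : Set ℝ := Icc (S.t i) (S.t (i + 1))
    let u : ℝ → EuclideanSpace ℝ (Fin n) := fun t ↦ S.chart i (c.extend t)
    let σ : ℝ → EuclideanSpace ℝ (Fin n) := fun t ↦
      mfderiv (𝓡 n) (𝓡 n) (S.chart i) (s t).proj (s t).snd
    ∀ t ∈ J, ∀ k : Fin n,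
      HasDerivWithinAt (fun τ ↦ σ τ k)
        (-∑ a : Fin n, ∑ b : Fin n,
          h.christoffel (S.chart i) k a b (u t) * derivWithin u J t a * σ t b) J t

/-- `P` is the parallel transport along `c` for the Levi-Civita connection of `h`. It is computed
in charts along a subdivision of `c`, piece by piece; the result does not depend on the choice,
because the existence of a metric of the class `Met` forces the changes of charts to be `C^2`. -/
def IsParallelTransport (h : Met n M) {x y : M} (c : Path x y)
    (P : TangentSpace (𝓡 n) x →ₗ[ℝ] TangentSpace (𝓡 n) y) : Prop :=
  ∃ S : ChartSubdivision n c, ∀ v : TangentSpace (𝓡 n) x,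
    ∃ s : ℝ → TangentBundle (𝓡 n) M, IsParallel h c S s ∧ s 0 = ⟨x, v⟩ ∧ s 1 = ⟨y, P v⟩

/-- The holonomy group `Hol_x(h)` of the Levi-Civita connection of `h`, as the set of the parallel
transports along all piecewise differentiable loops at `x`. -/
def Hol (x : M) (h : Met n M) : Set (TangentSpace (𝓡 n) x →ₗ[ℝ] TangentSpace (𝓡 n) x) :=
  {P | ∃ c : Path x x, IsPiecewiseC1 n c ∧ IsParallelTransport h c P}

variable (n M) in
/-- An orientation of `M`: an orientation of every tangent space, locally constant in charts, i.e.
bases at nearby points having the same components in a chart are both positive or both not. -/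
structure ManifoldOrientation where
  at_ : ∀ p : M, Orientation ℝ (TangentSpace (𝓡 n) p) (Fin n)
  locallyConstant : ∀ e ∈ atlas (EuclideanSpace ℝ (Fin n)) M, ∀ p ∈ e.source, ∀ᶠ q in 𝓝 p,
    ∀ (b : Module.Basis (Fin n) ℝ (TangentSpace (𝓡 n) p))
      (b' : Module.Basis (Fin n) ℝ (TangentSpace (𝓡 n) q)),
      (∀ i, (mfderiv (𝓡 n) (𝓡 n) e p (b i) : EuclideanSpace ℝ (Fin n))
        = mfderiv (𝓡 n) (𝓡 n) e q (b' i)) →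
      (b.orientation = at_ p ↔ b'.orientation = at_ q)

/-- `Hol_x(h) ⊆ H` up to conjugation in `SO(n)`: when `T_xM` is identified with `ℝ^n` through a
positively oriented `h`-orthonormal basis, some `SO(n)`-conjugate of `Hol_x(h)` lies in `H`. -/
def HolSubsetUpToConj (o : ManifoldOrientation n M)
    (H : Subgroup (Matrix.specialOrthogonalGroup (Fin n) ℝ)) (x : M) (h : Met n M) : Prop :=
  ∃ b : Module.Basis (Fin n) ℝ (TangentSpace (𝓡 n) x),
    b.orientation = o.at_ x ∧
    (∀ i j, h.inner x (b i) (b j) = if i = j then 1 else 0) ∧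
    ∃ U : Matrix.specialOrthogonalGroup (Fin n) ℝ, ∀ P ∈ Hol x h, ∃ A ∈ H,
      (U : Matrix (Fin n) (Fin n) ℝ) * LinearMap.toMatrix b b P *
        ((U⁻¹ : Matrix.specialOrthogonalGroup (Fin n) ℝ) : Matrix (Fin n) (Fin n) ℝ) =
      (A : Matrix (Fin n) (Fin n) ℝ)

end Holonomy

end

open Set Filter
open scoped Manifold Topology NNReal

noncomputable section

/-! Two facts carry the proof: holonomy along a fixed loop depends continuously on the metric, and
the auxiliary data (frame, conjugating matrix, element of `H`) range over compact sets.

Continuity: the Christoffel symbols are algebraic in the metric coefficients and their first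
derivatives, so convergence in the compact-open `C^1`-topology makes the coefficients of the linear
parallel transport equation converge uniformly along each piece of the loop
(`Met.tendstoUniformlyOn_connOp`). By Gronwall the solutions converge (`tendsto_of_linear_ode`), and
hence every holonomy of the limit metric `h` is a limit of holonomies of the metrics `g → h`
(`exists_tendsto_of_mem_Hol`).

Compactness: let an ultrafilter on the set converge to `h`. The `g`-orthonormal frames stay bounded,
because the forms at `x` converge to a positive definite one, so they converge to an `h`-orthonormal
frame of the same orientation; the conjugating matrices converge in the compact group `SO(n)`. For
each holonomy of `h`, the corresponding elements of `H` converge as well, and `H` is closed. The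
relation `U P = A U` passes to the limit. -/

/-! ### Linear ordinary differential equations: existence and continuous dependence -/

/-- Clipping each coordinate to `[-R, R]` makes a linear vector field bounded, as Picard-Lindelöf on
a prescribed interval requires, while preserving its growth estimate. -/
theorem exists_clip (ι : Type*) [Fintype ι] {R : ℝ} (hR : 0 ≤ R) :
    ∃ ρ : (ι → ℝ) → (ι → ℝ), LipschitzWith 1 ρ ∧ (∀ x, ‖ρ x‖ ≤ R) ∧ (∀ x, ‖ρ x‖ ≤ ‖x‖) ∧
      ∀ x, ‖x‖ ≤ R → ρ x = x := by
  have h : -R ≤ R := by linarith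
  refine ⟨fun x i ↦ (projIcc (-R) R h (x i) : ℝ), ?_, ?_, ?_, ?_⟩
  · refine LipschitzWith.of_dist_le_mul fun x y ↦ ?_
    rw [NNReal.coe_one, one_mul, dist_pi_le_iff dist_nonneg]
    intro i
    have := (LipschitzWith.projIcc h).dist_le_mul (x i) (y i)
    rw [NNReal.coe_one, one_mul] at this
    exact this.trans (dist_le_pi_dist x y i)
  · intro x
    rw [pi_norm_le_iff_of_nonneg hR]
    intro i
    rw [Real.norm_eq_abs, abs_le]
    exact (projIcc (-R) R h (x i)).2
  · intro x
    rw [pi_norm_le_iff_of_nonneg (norm_nonneg x)]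
    intro i
    refine le_trans ?_ (norm_le_pi_norm x i)
    simp only [coe_projIcc, Real.norm_eq_abs]
    rcases le_total 0 (x i) with h0 | h0
    · rw [abs_of_nonneg h0, abs_le]
      constructor
      · exact le_trans (by linarith) (le_max_right _ _ |>.trans' (le_min hR h0))
      · exact max_le (by linarith) (min_le_right _ _)
    · rw [abs_of_nonpos h0, abs_le]
      constructor
      · rw [neg_neg]; exact (le_min (by linarith) le_rfl).trans (le_max_right _ _)
      · exact max_le (by linarith) ((min_le_right _ _).trans (by linarith))
  · intro x hx
    ext i
    have := (norm_le_pi_norm x i).trans hx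
    rw [Real.norm_eq_abs, abs_le] at this
    simp only [projIcc_of_mem h this]

/-- A linear ODE with continuous coefficients has a solution on the whole interval. -/
theorem exists_linear_ode_pi {ι : Type*} [Fintype ι] {a b : ℝ} (hab : a ≤ b)
    {A : ℝ → (ι → ℝ) →L[ℝ] (ι → ℝ)} (hA : ContinuousOn A (Icc a b)) (x : ι → ℝ) :
    ∃ f : ℝ → ι → ℝ, f a = x ∧
      ∀ t ∈ Icc a b, HasDerivWithinAt f (A t (f t)) (Icc a b) t := by
  obtain ⟨C, hC⟩ := isCompact_Icc.exists_bound_of_continuousOn hA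
  lift C to ℝ≥0 using (norm_nonneg _).trans (hC a (left_mem_Icc.2 hab))
  -- The a priori bound for solutions of the unclipped equation on `[a, b]`, so clipping at `R` will
  -- not be felt.
  set R : ℝ := gronwallBound ‖x‖ C 0 (b - a) with hRdef
  have hR : 0 ≤ R := by rw [hRdef, gronwallBound_ε0]; positivity
  obtain ⟨ρ, hρl, hρR, hρx, hρ⟩ := exists_clip ι hR
  -- The clipped field has norm at most `C * R`, so in time `b - a` no solution leaves the ball of
  -- radius `C * R * (b - a)`.
  have key : IsPicardLindelof (fun t y ↦ A t (ρ y)) (⟨a, left_mem_Icc.2 hab⟩ : Icc a b) x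
      (C * R.toNNReal * (b - a).toNNReal) 0 (C * R.toNNReal) C := by
    refine ⟨fun t ht ↦ LipschitzWith.lipschitzOnWith ?_, fun y _ ↦ hA.clm_apply continuousOn_const,
      fun t ht y _ ↦ ?_, ?_⟩
    · refine LipschitzWith.of_dist_le_mul fun y z ↦ ?_
      rw [dist_eq_norm, ← map_sub]
      have h1 := hρl.dist_le_mul y z
      rw [NNReal.coe_one, one_mul, dist_eq_norm] at h1
      exact ((A t).le_opNorm _).trans
        (mul_le_mul (hC t ht) h1 (norm_nonneg _) C.2)
    · rw [NNReal.coe_mul, Real.coe_toNNReal R hR]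
      exact ((A t).le_opNorm _).trans (mul_le_mul (hC t ht) (hρR y) (norm_nonneg _) C.2)
    · have : 0 ≤ b - a := by linarith
      simp [this, hR]
  obtain ⟨f, hfa, hf⟩ := key.exists_eq_forall_mem_Icc_hasDerivWithinAt₀
  refine ⟨f, hfa, fun t ht ↦ ?_⟩
  -- Clipping does not increase norms, so `‖f'‖ ≤ C ‖f‖` holds and Gronwall keeps `f` within radius
  -- `R`, where the clip is the identity.
  have bound := norm_le_gronwallBound_of_norm_deriv_right_le (f := f)
    (f' := fun t ↦ A t (ρ (f t))) (δ := ‖x‖) (K := C) (ε := 0) (a := a) (b := b)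
    (fun t ht ↦ (hf t ht).continuousWithinAt)
    (fun t ht ↦ (hf t (Ico_subset_Icc_self ht)).mono_of_mem_nhdsWithin
      (Icc_mem_nhdsGE_of_mem ht)) (le_of_eq (by rw [← hfa]))
    (fun t ht ↦ by
      rw [add_zero]
      exact ((A t).le_opNorm _).trans (mul_le_mul (hC t (Ico_subset_Icc_self ht)) (hρx _)
        (norm_nonneg _) C.2))
  have h1 : ‖f t‖ ≤ R := (bound t ht).trans
    (gronwallBound_mono (norm_nonneg _) le_rfl C.2 (by linarith [ht.2]))
  have := hf t ht
  simp only [hρ _ h1] at this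
  exact this

/-- The solution operator of a linear ODE. -/
theorem exists_linear_ode_flow {ι : Type*} [Fintype ι] {a b : ℝ} (hab : a ≤ b)
    {A : ℝ → EuclideanSpace ℝ ι →L[ℝ] EuclideanSpace ℝ ι} (hA : ContinuousOn A (Icc a b)) :
    ∃ Φ : ℝ → EuclideanSpace ℝ ι →ₗ[ℝ] EuclideanSpace ℝ ι, Φ a = LinearMap.id ∧
      ∀ x, ∀ t ∈ Icc a b, HasDerivWithinAt (fun τ ↦ Φ τ x) (A t (Φ t x)) (Icc a b) t := by
  classical
  let e := EuclideanSpace.equiv ι ℝ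
  have hA' : ContinuousOn (fun t ↦ (e : EuclideanSpace ℝ ι →L[ℝ] ι → ℝ) ∘L A t ∘L
      (e.symm : (ι → ℝ) →L[ℝ] EuclideanSpace ℝ ι)) (Icc a b) :=
    continuousOn_const.clm_comp (hA.clm_comp continuousOn_const)
  -- Superposing the solutions that start at the basis vectors makes the flow linear by
  -- construction, without appeal to uniqueness.
  choose f hfa hf using fun i ↦ exists_linear_ode_pi hab hA' (e (EuclideanSpace.single i 1))
  have hcoord (x : EuclideanSpace ℝ ι) : ∑ i, x i • EuclideanSpace.single i (1 : ℝ) = x := by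
    ext j; simp [Finset.sum_apply, Pi.single_apply]
  refine ⟨fun t ↦ ∑ i, (EuclideanSpace.proj i : EuclideanSpace ℝ ι →L[ℝ] ℝ).toLinearMap.smulRight
    (e.symm (f i t)), ?_, fun x t ht ↦ ?_⟩
  · ext1 x
    simpa [hfa] using hcoord x
  · have h1 (i : ι) : HasDerivWithinAt (fun τ ↦ e.symm (f i τ)) (A t (e.symm (f i t)))
        (Icc a b) t := by
      have := (e.symm : (ι → ℝ) →L[ℝ] EuclideanSpace ℝ ι).hasFDerivAt.comp_hasDerivWithinAt t
        (hf i t ht)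
      simpa [Function.comp_def] using this
    have := HasDerivWithinAt.fun_sum (u := Finset.univ) fun i _ ↦ (h1 i).const_smul (x i)
    simpa using this

/-- Solutions of linear ODEs depend continuously on the coefficients and the initial values. -/
theorem tendsto_of_linear_ode {E : Type*} [NormedAddCommGroup E] [NormedSpace ℝ E]
    {X : Type*} {l : Filter X} {a b : ℝ} (hab : a ≤ b)
    {A : ℝ → E →L[ℝ] E} {B : X → ℝ → E →L[ℝ] E} (hA : ContinuousOn A (Icc a b))
    (hB : TendstoUniformlyOn B A l (Icc a b)) {f : ℝ → E} {g : X → ℝ → E}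
    (hf : ∀ t ∈ Icc a b, HasDerivWithinAt f (A t (f t)) (Icc a b) t)
    (hg : ∀ x, ∀ t ∈ Icc a b, HasDerivWithinAt (g x) (B x t (g x t)) (Icc a b) t)
    (h0 : Tendsto (fun x ↦ g x a) l (𝓝 (f a))) :
    Tendsto (fun x ↦ g x b) l (𝓝 (f b)) := by
  obtain ⟨K, hK⟩ := isCompact_Icc.exists_bound_of_continuousOn hA
  have hfc : ContinuousOn f (Icc a b) := fun t ht ↦ (hf t ht).continuousWithinAt
  obtain ⟨C, hC⟩ := isCompact_Icc.exists_bound_of_continuousOn hfc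
  have hK0 := (norm_nonneg _).trans (hK a (left_mem_Icc.2 hab))
  have hC0 := (norm_nonneg _).trans (hC a (left_mem_Icc.2 hab))
  set T : ℝ := b - a
  -- Here `p.1` stands for the initial distance and `p.2` for the error in the coefficients. The
  -- constant `K + 1` bounds `‖B x t‖` once that error is below 1.
  have hlim : Tendsto (fun p : ℝ × ℝ ↦ gronwallBound p.1 (K + 1) (p.2 * C) T)
      (𝓝 0 ×ˢ 𝓝[>] 0) (𝓝 0) := by
    have hK1 : K + 1 ≠ 0 := by positivity
    simp only [gronwallBound_of_K_ne_0 hK1]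
    have : Continuous fun p : ℝ × ℝ ↦ p.1 * Real.exp ((K + 1) * T) +
      p.2 * C / (K + 1) * (Real.exp ((K + 1) * T) - 1) := by fun_prop
    have := this.tendsto (0, 0)
    simp only [zero_mul, zero_div, add_zero, nhds_prod_eq] at this
    exact this.mono_left (Filter.prod_mono le_rfl nhdsWithin_le_nhds)
  rw [Metric.tendsto_nhds]
  intro η hη
  have h2 := hlim.eventually (gt_mem_nhds hη)
  obtain ⟨p, hp, q, hq, hpq⟩ := eventually_prod_iff.1 h2
  obtain ⟨ε, ⟨hqε, hε1⟩, hε0⟩ := ((hq.and (nhdsWithin_le_nhds (gt_mem_nhds one_pos))).and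
    self_mem_nhdsWithin).exists
  have hδ : Tendsto (fun x ↦ dist (g x a) (f a)) l (𝓝 0) := tendsto_iff_dist_tendsto_zero.1 h0
  filter_upwards [hδ.eventually hp, Metric.tendstoUniformlyOn_iff.1 hB ε hε0] with x hx hxB
  refine lt_of_le_of_lt ?_ (hpq hx hqε)
  have hval {t : ℝ} (ht : t ∈ Icc a b) : ‖A t - B x t‖ ≤ ε := by
    rw [← dist_eq_norm]; exact (hxB t ht).le
  have hmem {F : ℝ → E} {F' : ℝ → E}
      (hF : ∀ t ∈ Icc a b, HasDerivWithinAt F (F' t) (Icc a b) t) :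
      ∀ t ∈ Ico a b, HasDerivWithinAt F (F' t) (Ici t) t := fun t ht ↦
    (hF t (Ico_subset_Icc_self ht)).mono_of_mem_nhdsWithin (Icc_mem_nhdsGE_of_mem ht)
  -- `f` solves the equation of `B x` only up to the error `‖(A t - B x t) (f t)‖ ≤ ε * C`.
  have := dist_le_of_approx_trajectories_ODE_of_mem (v := fun t y ↦ B x t y) (s := fun _ ↦ univ)
    (K := (⟨K + 1, by positivity⟩ : ℝ≥0)) (f := g x) (g := f) (εf := 0) (εg := ε * C)
    (a := a) (b := b) (δ := dist (g x a) (f a))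
    (fun t ht ↦ LipschitzWith.lipschitzOnWith (LipschitzWith.of_dist_le_mul fun y z ↦ by
      rw [dist_eq_norm, dist_eq_norm, ← map_sub]
      refine ((B x t).le_opNorm _).trans (mul_le_mul_of_nonneg_right ?_ (norm_nonneg _))
      have h3 : B x t = A t - (A t - B x t) := by abel
      rw [h3]
      refine (norm_sub_le _ _).trans ?_
      exact add_le_add (hK t (Ico_subset_Icc_self ht))
        ((hval (Ico_subset_Icc_self ht)).trans hε1.le)))
    (fun t ht ↦ (hg x t ht).continuousWithinAt) (hmem (hg x)) (fun t _ ↦ by simp)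
    (fun _ _ ↦ trivial) hfc (hmem hf) (fun t ht ↦ by
      rw [dist_eq_norm, ← sub_apply]
      exact ((A t - B x t).le_opNorm _).trans (mul_le_mul (hval (Ico_subset_Icc_self ht))
        (hC t (Ico_subset_Icc_self ht)) (norm_nonneg _) (le_of_lt hε0)))
    (fun _ _ ↦ trivial) le_rfl b (right_mem_Icc.2 hab)
  rwa [zero_add] at this

/-! ### Locally uniform convergence as joint convergence -/

section UniformConvergence

/-- Limits along `l ×ˢ 𝓝[s] x` obey the usual rules for products and inverses, with no bounds to
track. This lemma and the next allow algebraic expressions to be treated there and then returned to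
locally uniform convergence. -/
theorem TendstoLocallyUniformlyOn.tendsto_prod {X α β : Type*} [TopologicalSpace α]
    [UniformSpace β] {F : X → α → β} {f : α → β} {l : Filter X} {s : Set α} {x : α}
    (hF : TendstoLocallyUniformlyOn F f l s) (hf : ContinuousOn f s) (hx : x ∈ s) :
    Tendsto (fun p : X × α ↦ F p.1 p.2) (l ×ˢ 𝓝[s] x) (𝓝 (f x)) := by
  rw [Uniform.tendsto_nhds_right]
  exact (Uniform.tendsto_nhds_right.1 ((hf x hx).tendsto.comp tendsto_snd)).uniformity_trans
    (tendstoLocallyUniformlyOn_iff_forall_tendsto.1 hF x hx)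

theorem tendstoLocallyUniformlyOn_of_tendsto_prod {X α β : Type*} [TopologicalSpace α]
    [UniformSpace β] {F : X → α → β} {f : α → β} {l : Filter X} {s : Set α}
    (hf : ContinuousOn f s)
    (hF : ∀ x ∈ s, Tendsto (fun p : X × α ↦ F p.1 p.2) (l ×ˢ 𝓝[s] x) (𝓝 (f x))) :
    TendstoLocallyUniformlyOn F f l s := by
  rw [tendstoLocallyUniformlyOn_iff_forall_tendsto]
  intro x hx
  exact (Uniform.tendsto_nhds_left.1 ((hf x hx).tendsto.comp tendsto_snd)).uniformity_trans
    (Uniform.tendsto_nhds_right.1 (hF x hx))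

end UniformConvergence

/-! ### Derivatives of charts -/

section Charts

variable {n : ℕ} {M : Type*} [TopologicalSpace M] [ChartedSpace (EuclideanSpace ℝ (Fin n)) M]

/-- The derivative of a chart, with the tangent spaces unfolded to the model space. -/
def chartDeriv (e : OpenPartialHomeomorph M (EuclideanSpace ℝ (Fin n))) (p : M) :
    EuclideanSpace ℝ (Fin n) →L[ℝ] EuclideanSpace ℝ (Fin n) :=
  mfderiv (𝓡 n) (𝓡 n) e p

/-- The derivative of an inverse chart, with the tangent spaces unfolded to the model space. -/
def chartSymmDeriv (e : OpenPartialHomeomorph M (EuclideanSpace ℝ (Fin n)))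
    (u : EuclideanSpace ℝ (Fin n)) :
    EuclideanSpace ℝ (Fin n) →L[ℝ] EuclideanSpace ℝ (Fin n) :=
  mfderiv (𝓡 n) (𝓡 n) e.symm u

variable {e : OpenPartialHomeomorph M (EuclideanSpace ℝ (Fin n))}

theorem chartSymmDeriv_chartDeriv [IsManifold (𝓡 n) 1 M]
    (he : e ∈ atlas (EuclideanSpace ℝ (Fin n)) M) {p : M} (hp : p ∈ e.source)
    (v : EuclideanSpace ℝ (Fin n)) : chartSymmDeriv e (e p) (chartDeriv e p v) = v :=
  DFunLike.congr_fun ((mdifferentiable_of_mem_atlas (I := 𝓡 n) he).symm_comp_deriv hp) v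

theorem chartDeriv_chartSymmDeriv [IsManifold (𝓡 n) 1 M]
    (he : e ∈ atlas (EuclideanSpace ℝ (Fin n)) M) {p : M} (hp : p ∈ e.source)
    (v : EuclideanSpace ℝ (Fin n)) : chartDeriv e p (chartSymmDeriv e (e p) v) = v := by
  have := DFunLike.congr_fun ((mdifferentiable_of_mem_atlas (I := 𝓡 n) he).comp_symm_deriv
    (e.map_source hp)) v
  have h2 : chartDeriv e (e.symm (e p)) (chartSymmDeriv e (e p) v) = v := this
  rwa [e.left_inv hp] at h2

end Charts

/-! ### Metrics and their coefficients in a chart -/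

section Metrics

variable {n : ℕ} {M : Type*} [TopologicalSpace M] [ChartedSpace (EuclideanSpace ℝ (Fin n)) M]

/-- The bilinear form of a metric at a point, with the tangent space unfolded to the model space. -/
def Met.form (h : Met n M) (p : M) :
    EuclideanSpace ℝ (Fin n) →L[ℝ] EuclideanSpace ℝ (Fin n) →L[ℝ] ℝ :=
  h.inner p

theorem Met.form_pos (h : Met n M) (p : M) {v : EuclideanSpace ℝ (Fin n)} (hv : v ≠ 0) :
    0 < h.form p v v :=
  h.pos p v hv

variable {e : OpenPartialHomeomorph M (EuclideanSpace ℝ (Fin n))}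

theorem Met.coeff_apply (h : Met n M) {p : M} (hp : p ∈ e.source) (i j : Fin n) :
    h.coeff e i j (e p) = h.form p (chartSymmDeriv e (e p) (EuclideanSpace.single i 1))
      (chartSymmDeriv e (e p) (EuclideanSpace.single j 1)) := by
  have : h.coeff e i j (e p) = h.form (e.symm (e p))
    (chartSymmDeriv e (e p) (EuclideanSpace.single i 1))
      (chartSymmDeriv e (e p) (EuclideanSpace.single j 1)) := rfl
  rw [this, e.left_inv hp]

theorem EuclideanSpace.sum_smul_single {ι : Type*} [Fintype ι] [DecidableEq ι]
    (x : EuclideanSpace ℝ ι) : ∑ i, x i • EuclideanSpace.single i (1 : ℝ) = x := by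
  ext j; simp [Finset.sum_apply, Pi.single_apply]

/-- The metric is determined by its coefficients in a chart. -/
theorem Met.form_eq_sum_coeff [IsManifold (𝓡 n) 1 M] (h : Met n M)
    (he : e ∈ atlas (EuclideanSpace ℝ (Fin n)) M) {p : M} (hp : p ∈ e.source) :
    h.form p = ∑ i, ∑ j, h.coeff e i j (e p) •
      ((EuclideanSpace.proj i : EuclideanSpace ℝ (Fin n) →L[ℝ] ℝ) ∘L chartDeriv e p).smulRight
      ((EuclideanSpace.proj j : EuclideanSpace ℝ (Fin n) →L[ℝ] ℝ) ∘L chartDeriv e p) := by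
  ext1 v
  ext1 w
  conv_lhs => rw [← chartSymmDeriv_chartDeriv he hp v, ← chartSymmDeriv_chartDeriv he hp w,
    ← EuclideanSpace.sum_smul_single (chartDeriv e p v),
    ← EuclideanSpace.sum_smul_single (chartDeriv e p w)]
  simp only [map_sum, map_smul, sum_apply, smul_apply, Met.coeff_apply h hp, smul_eq_mul,
    Finset.mul_sum, ContinuousLinearMap.smulRight_apply, ContinuousLinearMap.comp_apply,
    PiLp.proj_apply]
  rw [Finset.sum_comm]
  refine Finset.sum_congr rfl fun i _ ↦ Finset.sum_congr rfl fun j _ ↦ by ring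

/-- A kernel vector of the Gram matrix would yield a nonzero tangent vector of length zero. -/
theorem Met.det_coeff_ne_zero [IsManifold (𝓡 n) 1 M] (h : Met n M)
    (he : e ∈ atlas (EuclideanSpace ℝ (Fin n)) M) {p : M} (hp : p ∈ e.source) :
    (Matrix.of fun a b : Fin n ↦ h.coeff e a b (e p)).det ≠ 0 := by
  intro hdet
  obtain ⟨x, hx0, hx⟩ := Matrix.exists_mulVec_eq_zero_iff.2 hdet
  set w : EuclideanSpace ℝ (Fin n) := WithLp.toLp 2 x
  have hw : w ≠ 0 := fun h0 ↦ hx0 (by simpa [w] using h0)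
  set v := chartSymmDeriv e (e p) w
  have hv : chartDeriv e p v = w := chartDeriv_chartSymmDeriv he hp w
  have hv0 : v ≠ 0 := fun h0 ↦ hw (by rw [← hv, h0, map_zero])
  refine (h.form_pos p hv0).ne' ?_
  rw [h.form_eq_sum_coeff he hp]
  have h1 (i : Fin n) : ∑ j, h.coeff e i j (e p) * x j = 0 := congrFun hx i
  simp only [sum_apply, smul_apply, ContinuousLinearMap.smulRight_apply,
    ContinuousLinearMap.comp_apply, hv, PiLp.proj_apply, smul_eq_mul]
  refine Finset.sum_eq_zero fun i _ ↦ ?_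
  have : ∀ j, h.coeff e i j (e p) * (w i * w j) = w i * (h.coeff e i j (e p) * x j) := fun j ↦ by
    change _ * (w i * x j) = _
    ring
  simp only [this, ← Finset.mul_sum, h1, mul_zero]

theorem Met.eventually_mem_basicNhd (h : Met n M) (he : e ∈ atlas (EuclideanSpace ℝ (Fin n)) M)
    {K : Set M} (hK : IsCompact K) (hKe : K ⊆ e.source) {ε : ℝ} (hε : 0 < ε) :
    ∀ᶠ g in 𝓝 h, g ∈ h.basicNhd e K ε := by
  refine IsOpen.mem_nhds (TopologicalSpace.isOpen_generateFrom_of_mem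
    ⟨h, e, K, ε, he, hK, hKe, hε, rfl⟩) fun p _ i j ↦ ?_
  simpa using hε

theorem Met.tendsto_coeff (h : Met n M) (he : e ∈ atlas (EuclideanSpace ℝ (Fin n)) M)
    {p : M} (hp : p ∈ e.source) (i j : Fin n) :
    Tendsto (fun g : Met n M ↦ g.coeff e i j (e p)) (𝓝 h) (𝓝 (h.coeff e i j (e p))) := by
  rw [Metric.tendsto_nhds]
  intro ε hε
  filter_upwards [h.eventually_mem_basicNhd he isCompact_singleton
    (singleton_subset_iff.2 hp) hε] with g hg
  exact (hg p rfl i j).1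

theorem Met.tendsto_form [IsManifold (𝓡 n) 1 M] (h : Met n M) (p : M) :
    Tendsto (fun g : Met n M ↦ g.form p) (𝓝 h) (𝓝 (h.form p)) := by
  have he := chart_mem_atlas (EuclideanSpace ℝ (Fin n)) p
  have hp := mem_chart_source (EuclideanSpace ℝ (Fin n)) p
  simp only [fun g : Met n M ↦ g.form_eq_sum_coeff he hp]
  have : IsTopologicalAddGroup
    (EuclideanSpace ℝ (Fin n) →L[ℝ] EuclideanSpace ℝ (Fin n) →L[ℝ] ℝ) := inferInstance
  have := this.toContinuousAdd
  exact tendsto_finsetSum _ fun i _ ↦ tendsto_finsetSum _ fun j _ ↦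
    (h.tendsto_coeff he hp i j).smul_const _

/-- The unit ball of the form is von Neumann bounded, hence lies in a ball of some radius `R`;
homogeneity gives the constant `2 * R ^ 2`. -/
theorem Met.exists_norm_sq_le_form (h : Met n M) (p : M) :
    ∃ C : ℝ, 0 < C ∧ ∀ v, ‖v‖ ^ 2 ≤ C * h.form p v v := by
  have hb : Bornology.IsVonNBounded ℝ {v : EuclideanSpace ℝ (Fin n) | h.form p v v < 1} :=
    h.isVonNBounded p
  obtain ⟨R, hR, hsub⟩ := ((NormedSpace.isVonNBounded_iff ℝ).1 hb).exists_pos_norm_le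
  refine ⟨2 * R ^ 2, by positivity, fun v ↦ ?_⟩
  by_cases hv : v = 0
  · simp [hv]
  have hq := h.form_pos p hv
  set q := h.form p v v
  -- This scaling gives `r • v` the form value 1/2, strictly inside the unit ball.
  set r := (√(2 * q))⁻¹
  have hr : 0 < r := by positivity
  have hr2 : r ^ 2 = (2 * q)⁻¹ := by rw [inv_pow, Real.sq_sqrt (by positivity)]
  have h1 : h.form p (r • v) (r • v) < 1 := by
    have : h.form p (r • v) (r • v) = r ^ 2 * q := by simp [q]; ring
    rw [this, hr2]
    field_simp
    norm_num
  have h2 := hsub _ h1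
  rw [norm_smul, Real.norm_eq_abs, abs_of_pos hr] at h2
  have h3 : (r * ‖v‖) ^ 2 ≤ R ^ 2 := pow_le_pow_left₀ (by positivity) h2 2
  rw [mul_pow, hr2] at h3
  rw [inv_mul_le_iff₀ (by positivity)] at h3
  linarith

end Metrics

/-! ### Christoffel symbols and the coefficient of the transport equation -/

section Christoffel

variable {n : ℕ} {M : Type*} [TopologicalSpace M] [ChartedSpace (EuclideanSpace ℝ (Fin n)) M]
  {e : OpenPartialHomeomorph M (EuclideanSpace ℝ (Fin n))}

theorem Met.continuousOn_fderiv_coeff (h : Met n M) (he : e ∈ atlas (EuclideanSpace ℝ (Fin n)) M)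
    (i j : Fin n) : ContinuousOn (fderiv ℝ (h.coeff e i j)) e.target :=
  (h.contDiffOn_coeff e he i j).continuousOn_fderiv_of_isOpen e.open_target le_rfl

/-- Joint continuity of the Christoffel symbols in the metric and the point, in abstract form. -/
theorem tendsto_christoffel [IsManifold (𝓡 n) 1 M] {X : Type*} {l : Filter X} {G : X → Met n M}
    {q : X → EuclideanSpace ℝ (Fin n)} (h : Met n M)
    (he : e ∈ atlas (EuclideanSpace ℝ (Fin n)) M) {p : M} (hp : p ∈ e.source)
    (h0 : ∀ i j, Tendsto (fun x ↦ (G x).coeff e i j (q x)) l (𝓝 (h.coeff e i j (e p))))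
    (h1 : ∀ i j, Tendsto (fun x ↦ fderiv ℝ ((G x).coeff e i j) (q x)) l
      (𝓝 (fderiv ℝ (h.coeff e i j) (e p)))) (k i j : Fin n) :
    Tendsto (fun x ↦ (G x).christoffel e k i j (q x)) l (𝓝 (h.christoffel e k i j (e p))) := by
  have hm : Tendsto (fun x ↦ Matrix.of fun a b : Fin n ↦ (G x).coeff e a b (q x)) l
      (𝓝 (Matrix.of fun a b : Fin n ↦ h.coeff e a b (e p))) :=
    tendsto_pi_nhds.2 fun a ↦ tendsto_pi_nhds.2 fun b ↦ h0 a b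
  have hinv : Tendsto (fun x ↦ (Matrix.of fun a b : Fin n ↦ (G x).coeff e a b (q x))⁻¹) l
      (𝓝 (Matrix.of fun a b : Fin n ↦ h.coeff e a b (e p))⁻¹) := by
    -- The inverse is the adjugate over the determinant, which is nonzero at the limit.
    simp only [Matrix.inv_def, Ring.inverse_eq_inv']
    have hdet := ((continuous_id.matrix_det).tendsto _).comp hm
    have hadj := ((continuous_id.matrix_adjugate).tendsto _).comp hm
    exact (hdet.inv₀ (h.det_coeff_ne_zero he hp)).smul hadj
  have happ (v : EuclideanSpace ℝ (Fin n)) (a b : Fin n) :=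
    ((ContinuousLinearMap.apply ℝ ℝ v).continuous.tendsto _).comp (h1 a b)
  refine Tendsto.const_mul _ (tendsto_finsetSum _ fun m _ ↦ Tendsto.mul ?_ ?_)
  · exact tendsto_pi_nhds.1 (tendsto_pi_nhds.1 hinv k) m
  · exact ((happ _ j m).add (happ _ i m)).sub (happ _ i j)

/-- The linear map `σ ↦ -(∑ Γ^k_{ab} w_a σ_b)_k` at the point `u`, the coefficient of the equation
of parallel transport along a curve through `u` with velocity `w`. -/
def Met.connOp (h : Met n M) (e : OpenPartialHomeomorph M (EuclideanSpace ℝ (Fin n)))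
    (u w : EuclideanSpace ℝ (Fin n)) : EuclideanSpace ℝ (Fin n) →L[ℝ] EuclideanSpace ℝ (Fin n) :=
  ∑ k, ∑ b, (-∑ a, h.christoffel e k a b u * w a) •
    (EuclideanSpace.proj b : EuclideanSpace ℝ (Fin n) →L[ℝ] ℝ).smulRight
      (EuclideanSpace.single k (1 : ℝ))

theorem Met.connOp_apply (h : Met n M) (e : OpenPartialHomeomorph M (EuclideanSpace ℝ (Fin n)))
    (u w σ : EuclideanSpace ℝ (Fin n)) (k : Fin n) :
    h.connOp e u w σ k = -∑ a, ∑ b, h.christoffel e k a b u * w a * σ b := by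
  simp only [Met.connOp, sum_apply, smul_apply, ContinuousLinearMap.smulRight_apply,
    PiLp.proj_apply, WithLp.ofLp_sum, WithLp.ofLp_smul, Finset.sum_apply, Pi.smul_apply,
    PiLp.single_apply, smul_eq_mul, mul_ite, mul_one, mul_zero, neg_mul,
    Finset.sum_mul]
  rw [Finset.sum_comm]
  simp [Finset.sum_comm (f := fun a b ↦ h.christoffel e k a b u * w a * σ b)]

theorem tendsto_connOp [IsManifold (𝓡 n) 1 M] {X : Type*} {l : Filter X} {G : X → Met n M}
    {q w : X → EuclideanSpace ℝ (Fin n)} {w₀ : EuclideanSpace ℝ (Fin n)} (h : Met n M)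
    (he : e ∈ atlas (EuclideanSpace ℝ (Fin n)) M) {p : M} (hp : p ∈ e.source)
    (h0 : ∀ i j, Tendsto (fun x ↦ (G x).coeff e i j (q x)) l (𝓝 (h.coeff e i j (e p))))
    (h1 : ∀ i j, Tendsto (fun x ↦ fderiv ℝ ((G x).coeff e i j) (q x)) l
      (𝓝 (fderiv ℝ (h.coeff e i j) (e p)))) (hw : Tendsto w l (𝓝 w₀)) :
    Tendsto (fun x ↦ (G x).connOp e (q x) (w x)) l (𝓝 (h.connOp e (e p) w₀)) := by
  refine tendsto_finsetSum _ fun k _ ↦ tendsto_finsetSum _ fun b _ ↦ Tendsto.smul_const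
    (Tendsto.neg (tendsto_finsetSum _ fun a _ ↦
      (tendsto_christoffel h he hp h0 h1 k a b).mul ?_)) _
  exact ((EuclideanSpace.proj a : EuclideanSpace ℝ (Fin n) →L[ℝ] ℝ).continuous.tendsto _).comp hw

variable {c : ℝ → M} {J : Set ℝ} {w : ℝ → EuclideanSpace ℝ (Fin n)}

theorem Met.continuousOn_coeff_comp (h : Met n M) (he : e ∈ atlas (EuclideanSpace ℝ (Fin n)) M)
    (hc : ContinuousOn c J) (hcJ : MapsTo c J e.source) (i j : Fin n) :
    ContinuousOn (fun t ↦ h.coeff e i j (e (c t))) J :=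
  (h.contDiffOn_coeff e he i j).continuousOn.comp (e.continuousOn.comp hc hcJ)
    fun _ ht ↦ e.map_source (hcJ ht)

theorem Met.continuousOn_fderiv_coeff_comp (h : Met n M)
    (he : e ∈ atlas (EuclideanSpace ℝ (Fin n)) M)
    (hc : ContinuousOn c J) (hcJ : MapsTo c J e.source) (i j : Fin n) :
    ContinuousOn (fun t ↦ fderiv ℝ (h.coeff e i j) (e (c t))) J :=
  (h.continuousOn_fderiv_coeff he i j).comp (e.continuousOn.comp hc hcJ)
    fun _ ht ↦ e.map_source (hcJ ht)

theorem Met.continuousOn_connOp [IsManifold (𝓡 n) 1 M] (h : Met n M)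
    (he : e ∈ atlas (EuclideanSpace ℝ (Fin n)) M)
    (hc : ContinuousOn c J) (hcJ : MapsTo c J e.source) (hw : ContinuousOn w J) :
    ContinuousOn (fun t ↦ h.connOp e (e (c t)) (w t)) J := fun t ht ↦
  tendsto_connOp (G := fun _ ↦ h) h he (hcJ ht)
    (fun i j ↦ h.continuousOn_coeff_comp he hc hcJ i j t ht)
    (fun i j ↦ h.continuousOn_fderiv_coeff_comp he hc hcJ i j t ht) (hw t ht)

/-- The compact-open `C^1`-topology enters here: a basic neighbourhood over the compact image `c ''
J` controls the coefficients and first derivatives, and the Christoffel symbols involve nothing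
else. Compactness of `J` turns local uniformity into uniformity. -/
theorem Met.tendstoUniformlyOn_connOp [IsManifold (𝓡 n) 1 M] (h : Met n M)
    (he : e ∈ atlas (EuclideanSpace ℝ (Fin n)) M) (hJ : IsCompact J)
    (hc : ContinuousOn c J) (hcJ : MapsTo c J e.source) (hw : ContinuousOn w J) :
    TendstoUniformlyOn (fun (g : Met n M) t ↦ g.connOp e (e (c t)) (w t))
      (fun t ↦ h.connOp e (e (c t)) (w t)) (𝓝 h) J := by
  rw [← tendstoLocallyUniformlyOn_iff_tendstoUniformlyOn_of_compact hJ]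
  refine tendstoLocallyUniformlyOn_of_tendsto_prod (h.continuousOn_connOp he hc hcJ hw)
    fun t ht ↦ ?_
  have hev {ε : ℝ} (hε : 0 < ε) := h.eventually_mem_basicNhd he (hJ.image_of_continuousOn hc)
    (image_subset_iff.2 hcJ) hε
  refine tendsto_connOp (G := fun x : Met n M × ℝ ↦ x.1) (q := fun x ↦ e (c x.2))
    (w := fun x ↦ w x.2) h he (hcJ ht) (fun i j ↦ ?_) (fun i j ↦ ?_)
    ((hw t ht).tendsto.comp tendsto_snd)
  · refine TendstoLocallyUniformlyOn.tendsto_prod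
      (F := fun (g : Met n M) t ↦ g.coeff e i j (e (c t)))
      (f := fun t ↦ h.coeff e i j (e (c t)))
      (TendstoUniformlyOn.tendstoLocallyUniformlyOn ?_)
      (h.continuousOn_coeff_comp he hc hcJ i j) ht
    refine Metric.tendstoUniformlyOn_iff.2 fun ε hε ↦ ?_
    filter_upwards [hev hε] with g hg τ hτ
    rw [dist_comm]
    exact (hg _ (mem_image_of_mem c hτ) i j).1
  · refine TendstoLocallyUniformlyOn.tendsto_prod
      (F := fun (g : Met n M) t ↦ fderiv ℝ (g.coeff e i j) (e (c t)))
      (f := fun t ↦ fderiv ℝ (h.coeff e i j) (e (c t)))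
      (TendstoUniformlyOn.tendstoLocallyUniformlyOn ?_)
      (h.continuousOn_fderiv_coeff_comp he hc hcJ i j) ht
    refine Metric.tendstoUniformlyOn_iff.2 fun ε hε ↦ ?_
    filter_upwards [hev hε] with g hg τ hτ
    rw [dist_comm, dist_eq_norm]
    exact (hg _ (mem_image_of_mem c hτ) i j).2

end Christoffel

/-! ### Parallel transport: existence and continuity in the metric -/

section ParallelTransport

theorem hasDerivWithinAt_euclideanSpace_iff {ι : Type*} [Fintype ι] {σ : ℝ → EuclideanSpace ℝ ι}
    {v : EuclideanSpace ℝ ι} {J : Set ℝ} {t : ℝ} :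
    HasDerivWithinAt σ v J t ↔ ∀ k, HasDerivWithinAt (fun τ ↦ σ τ k) (v k) J t := by
  rw [hasDerivWithinAt_iff_hasFDerivWithinAt, hasFDerivWithinAt_euclidean]
  refine forall_congr' fun k ↦ ?_
  rw [hasDerivWithinAt_iff_hasFDerivWithinAt]
  refine iff_of_eq (congrArg (fun L ↦ HasFDerivWithinAt (fun τ ↦ σ τ k) L J t) ?_)
  ext
  simp

variable {n : ℕ} {M : Type*} [TopologicalSpace M] [ChartedSpace (EuclideanSpace ℝ (Fin n)) M]
  {x y : M} {c : Path x y}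

theorem ChartSubdivision.t_mono (S : ChartSubdivision n c) {i j : ℕ} (hij : i ≤ j)
    (hj : j ≤ S.m) : S.t i ≤ S.t j := by
  induction j, hij using Nat.le_induction with
  | base => exact le_rfl
  | succ k hk ih => exact (ih (by omega)).trans (S.t_lt k (by omega)).le

theorem ChartSubdivision.Icc_subset (S : ChartSubdivision n c) {i : ℕ} (hi : i < S.m) :
    Icc (S.t i) (S.t (i + 1)) ⊆ Icc 0 1 := by
  refine Icc_subset_Icc ?_ ?_
  · rw [← S.t_zero]; exact S.t_mono (Nat.zero_le _) hi.le
  · rw [← S.t_last]; exact S.t_mono hi le_rfl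

/-- The fibre component of a tangent vector, in the model space. -/
def fiberVec (s : TangentBundle (𝓡 n) M) : EuclideanSpace ℝ (Fin n) := s.snd

theorem tangentBundle_mk_eq {p q : M} (hpq : p = q) {v w : EuclideanSpace ℝ (Fin n)} (hvw : v = w) :
    (⟨p, v⟩ : TangentBundle (𝓡 n) M) = ⟨q, w⟩ := by
  subst hpq hvw; rfl

/-- The coefficient of the equation of parallel transport along `c` in the chart `e`. -/
def Met.pathOp (h : Met n M) (c : ℝ → M) (e : OpenPartialHomeomorph M (EuclideanSpace ℝ (Fin n)))
    (J : Set ℝ) (t : ℝ) : EuclideanSpace ℝ (Fin n) →L[ℝ] EuclideanSpace ℝ (Fin n) :=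
  h.connOp e (e (c t)) (derivWithin (fun τ ↦ e (c τ)) J t)

/-- The equation of parallel transport for a field of vectors of the model space along `c`, in the
chart `e`. -/
def Met.IsParallelOn (h : Met n M) (c : ℝ → M)
    (e : OpenPartialHomeomorph M (EuclideanSpace ℝ (Fin n))) (J : Set ℝ)
    (w : ℝ → EuclideanSpace ℝ (Fin n)) : Prop :=
  ∀ t ∈ J, HasDerivWithinAt (fun τ ↦ chartDeriv e (c τ) (w τ))
    (h.pathOp c e J t (chartDeriv e (c t) (w t))) J t

/-- Fields are kept as vectors in the tangent spaces rather than as chart components, so consecutive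
pieces can be joined without computing a change of charts. -/
theorem isParallel_iff (h : Met n M) (S : ChartSubdivision n c)
    {s : ℝ → TangentBundle (𝓡 n) M} :
    IsParallel h c S s ↔ (∀ t ∈ Icc (0 : ℝ) 1, (s t).proj = c.extend t) ∧ ∀ i < S.m,
      h.IsParallelOn c.extend (S.chart i) (Icc (S.t i) (S.t (i + 1))) (fun t ↦ fiberVec (s t)) := by
  refine and_congr_right fun hs ↦ forall₂_congr fun i hi ↦ forall₂_congr fun t ht ↦ ?_
  have hσ : ∀ τ ∈ Icc (S.t i) (S.t (i + 1)),
      (mfderiv (𝓡 n) (𝓡 n) (S.chart i) (s τ).proj (s τ).snd : EuclideanSpace ℝ (Fin n)) =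
        chartDeriv (S.chart i) (c.extend τ) (fiberVec (s τ)) := fun τ hτ ↦
    congrArg (fun p ↦ chartDeriv (S.chart i) p (fiberVec (s τ))) (hs τ (S.Icc_subset hi hτ))
  rw [hasDerivWithinAt_euclideanSpace_iff]
  refine forall_congr' fun k ↦ ?_
  have h1 := Met.connOp_apply h (S.chart i) (S.chart i (c.extend t))
    (derivWithin (fun τ ↦ S.chart i (c.extend τ)) (Icc (S.t i) (S.t (i + 1))) t)
    (chartDeriv (S.chart i) (c.extend t) (fiberVec (s t))) k
  rw [Met.pathOp, h1, ← hσ t ht]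
  constructor
  · exact fun h2 ↦ h2.congr (fun τ hτ ↦ by rw [← hσ τ hτ]) (by rw [← hσ t ht])
  · exact fun h2 ↦ h2.congr (fun τ hτ ↦ by rw [← hσ τ hτ]) (by rw [← hσ t ht])

section Piece

variable {e : OpenPartialHomeomorph M (EuclideanSpace ℝ (Fin n))} {a b : ℝ} {γ : ℝ → M}

theorem continuousOn_derivWithin_chart_comp [IsManifold (𝓡 n) 1 M]
    (he : e ∈ atlas (EuclideanSpace ℝ (Fin n)) M) (hab : a < b)
    (hγ : ContMDiffOn 𝓘(ℝ, ℝ) (𝓡 n) 1 γ (Icc a b)) (hm : MapsTo γ (Icc a b) e.source) :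
    ContinuousOn (fun t ↦ derivWithin (fun τ ↦ e (γ τ)) (Icc a b) t) (Icc a b) := by
  have h1 : ContMDiffOn 𝓘(ℝ, ℝ) (𝓡 n) 1 (e ∘ γ) (Icc a b) :=
    (contMDiffOn_of_mem_maximalAtlas (IsManifold.subset_maximalAtlas he)).comp hγ hm
  exact (contMDiffOn_iff_contDiffOn.1 h1).continuousOn_derivWithin (uniqueDiffOn_Icc hab) le_rfl

/-- Parallel transport exists along a curve inside a chart. -/
theorem Met.exists_isParallelOn [IsManifold (𝓡 n) 1 M] (h : Met n M)
    (he : e ∈ atlas (EuclideanSpace ℝ (Fin n)) M) (hab : a < b)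
    (hγ : ContMDiffOn 𝓘(ℝ, ℝ) (𝓡 n) 1 γ (Icc a b)) (hm : MapsTo γ (Icc a b) e.source) :
    ∃ Q : EuclideanSpace ℝ (Fin n) →ₗ[ℝ] EuclideanSpace ℝ (Fin n), ∀ v,
      ∃ w : ℝ → EuclideanSpace ℝ (Fin n), h.IsParallelOn γ e (Icc a b) w ∧ w a = v ∧ w b = Q v := by
  obtain ⟨Φ, hΦa, hΦ⟩ := exists_linear_ode_flow hab.le (h.continuousOn_connOp he hγ.continuousOn hm
    (continuousOn_derivWithin_chart_comp he hab hγ hm))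
  refine ⟨(chartSymmDeriv e (e (γ b))).toLinearMap ∘ₗ Φ b ∘ₗ (chartDeriv e (γ a)).toLinearMap,
    fun v ↦ ⟨fun t ↦ chartSymmDeriv e (e (γ t)) (Φ t (chartDeriv e (γ a) v)), fun t ht ↦ ?_, ?_,
      rfl⟩⟩
  · simp only [chartDeriv_chartSymmDeriv he (hm ht)]
    exact (hΦ (chartDeriv e (γ a) v) t ht).congr
      (fun τ hτ ↦ chartDeriv_chartSymmDeriv he (hm hτ) _) (chartDeriv_chartSymmDeriv he (hm ht) _)
  · simp only [hΦa, LinearMap.id_apply]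
    exact chartSymmDeriv_chartDeriv he (hm (left_mem_Icc.2 hab.le)) v

/-- Parallel fields along a curve inside a chart depend continuously on the metric and the initial
value. -/
theorem Met.tendsto_isParallelOn [IsManifold (𝓡 n) 1 M] (h : Met n M)
    (he : e ∈ atlas (EuclideanSpace ℝ (Fin n)) M) (hab : a < b)
    (hγ : ContMDiffOn 𝓘(ℝ, ℝ) (𝓡 n) 1 γ (Icc a b)) (hm : MapsTo γ (Icc a b) e.source)
    {w : ℝ → EuclideanSpace ℝ (Fin n)} {W : Met n M → ℝ → EuclideanSpace ℝ (Fin n)}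
    (hw : h.IsParallelOn γ e (Icc a b) w) (hW : ∀ g : Met n M, g.IsParallelOn γ e (Icc a b) (W g))
    (h0 : Tendsto (fun g ↦ W g a) (𝓝 h) (𝓝 (w a))) :
    Tendsto (fun g ↦ W g b) (𝓝 h) (𝓝 (w b)) := by
  have hd := continuousOn_derivWithin_chart_comp he hab hγ hm
  have h1 := tendsto_of_linear_ode hab.le (h.continuousOn_connOp he hγ.continuousOn hm hd)
    (h.tendstoUniformlyOn_connOp he isCompact_Icc hγ.continuousOn hm hd)
    (f := fun τ ↦ chartDeriv e (γ τ) (w τ)) (g := fun g τ ↦ chartDeriv e (γ τ) (W g τ)) hw hW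
    (((chartDeriv e (γ a)).continuous.tendsto _).comp h0)
  have hb := hm (right_mem_Icc.2 hab.le)
  simpa only [Function.comp_def, chartSymmDeriv_chartDeriv he hb] using
    ((chartSymmDeriv e (e (γ b))).continuous.tendsto _).comp h1

theorem Met.IsParallelOn.congr {h : Met n M} {J : Set ℝ} {w w' : ℝ → EuclideanSpace ℝ (Fin n)}
    (hw : h.IsParallelOn γ e J w) (hww : EqOn w' w J) : h.IsParallelOn γ e J w' := fun t ht ↦ by
  rw [hww ht]
  exact (hw t ht).congr (fun τ hτ ↦ by rw [hww hτ]) (by rw [hww ht])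

end Piece

/-- Solutions on successive pieces are glued. Since derivatives are taken within each closed piece,
only the values need to agree at a break point, and no differentiability across it is asked for. -/
theorem exists_isParallelOn_initial [IsManifold (𝓡 n) 1 M] (h : Met n M) (S : ChartSubdivision n c)
    (k : ℕ) (hk : k ≤ S.m) :
    ∃ Q : EuclideanSpace ℝ (Fin n) →ₗ[ℝ] EuclideanSpace ℝ (Fin n), ∀ v,
      ∃ w : ℝ → EuclideanSpace ℝ (Fin n), w 0 = v ∧ w (S.t k) = Q v ∧ ∀ i < k,
        h.IsParallelOn c.extend (S.chart i) (Icc (S.t i) (S.t (i + 1))) w := by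
  induction k with
  | zero => exact ⟨LinearMap.id, fun v ↦ ⟨fun _ ↦ v, rfl, rfl, fun i hi ↦ absurd hi (by omega)⟩⟩
  | succ k ih =>
    obtain ⟨Q, hQ⟩ := ih (by omega)
    have hkm : k < S.m := hk
    obtain ⟨R, hR⟩ := h.exists_isParallelOn (S.chart_mem k hkm) (S.t_lt k hkm)
      (S.contMDiffOn k hkm) (S.mapsTo k hkm)
    refine ⟨R ∘ₗ Q, fun v ↦ ?_⟩
    obtain ⟨w, hw0, hwk, hw⟩ := hQ v
    obtain ⟨z, hz, hzk, hzk'⟩ := hR (Q v)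
    have h0 : 0 ≤ S.t k := by rw [← S.t_zero]; exact S.t_mono (Nat.zero_le _) hkm.le
    refine ⟨fun t ↦ if t ≤ S.t k then w t else z t, ?_, ?_, fun i hi ↦ ?_⟩
    · simp only [if_pos h0, hw0]
    · simp only [if_neg (S.t_lt k hkm).not_ge, hzk', LinearMap.comp_apply]
    · rcases Nat.lt_succ_iff_lt_or_eq.1 hi with hi | rfl
      · refine (hw i hi).congr fun t ht ↦ ?_
        exact if_pos (ht.2.trans (S.t_mono hi hkm.le))
      · refine hz.congr fun t ht ↦ ?_
        rcases ht.1.eq_or_lt with rfl | hlt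
        · simp only [le_refl, if_true, hwk, hzk]
        · exact if_neg hlt.not_ge

/-- Parallel transport exists along every path with a given chart subdivision. -/
theorem exists_isParallel [IsManifold (𝓡 n) 1 M] (h : Met n M) (S : ChartSubdivision n c) :
    ∃ Q : EuclideanSpace ℝ (Fin n) →ₗ[ℝ] EuclideanSpace ℝ (Fin n),
      ∀ v : EuclideanSpace ℝ (Fin n), ∃ s : ℝ → TangentBundle (𝓡 n) M,
        IsParallel h c S s ∧ s 0 = ⟨x, v⟩ ∧ s 1 = ⟨y, Q v⟩ := by
  obtain ⟨Q, hQ⟩ := exists_isParallelOn_initial h S S.m le_rfl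
  refine ⟨Q, fun v ↦ ?_⟩
  obtain ⟨w, hw0, hw1, hw⟩ := hQ v
  rw [S.t_last] at hw1
  refine ⟨fun t ↦ ⟨c.extend t, w t⟩, (isParallel_iff h S).2 ⟨fun _ _ ↦ rfl, hw⟩,
    tangentBundle_mk_eq c.extend_zero hw0, tangentBundle_mk_eq c.extend_one hw1⟩

/-- Parallel transport depends continuously on the metric. -/
theorem tendsto_isParallel [IsManifold (𝓡 n) 1 M] (h : Met n M) (S : ChartSubdivision n c)
    {s : ℝ → TangentBundle (𝓡 n) M} {s' : Met n M → ℝ → TangentBundle (𝓡 n) M}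
    (hs : IsParallel h c S s) (hs' : ∀ g, IsParallel g c S (s' g))
    (h0 : ∀ g, fiberVec (s' g 0) = fiberVec (s 0)) :
    Tendsto (fun g ↦ fiberVec (s' g 1)) (𝓝 h) (𝓝 (fiberVec (s 1))) := by
  -- Induction along the subdivision: convergence at the end of one piece is convergence of the
  -- initial values on the next.
  suffices ∀ k ≤ S.m,
      Tendsto (fun g ↦ fiberVec (s' g (S.t k))) (𝓝 h) (𝓝 (fiberVec (s (S.t k)))) by
    simpa only [S.t_last] using this S.m le_rfl
  intro k
  induction k with
  | zero =>
    intro _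
    simp only [S.t_zero, h0]
    exact tendsto_const_nhds
  | succ k ih =>
    intro hk
    have hkm : k < S.m := hk
    exact h.tendsto_isParallelOn (S.chart_mem k hkm) (S.t_lt k hkm) (S.contMDiffOn k hkm)
      (S.mapsTo k hkm) (((isParallel_iff h S).1 hs).2 k hkm)
      (fun g ↦ ((isParallel_iff g S).1 (hs' g)).2 k hkm) (ih hkm.le)

/-- Every holonomy of `h` is a pointwise limit of holonomies of the metrics `g → h`. -/
theorem exists_tendsto_of_mem_Hol [IsManifold (𝓡 n) 1 M] (h : Met n M) {x : M}
    {P : EuclideanSpace ℝ (Fin n) →ₗ[ℝ] EuclideanSpace ℝ (Fin n)} (hP : P ∈ Hol x h) :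
    ∃ Q : Met n M → EuclideanSpace ℝ (Fin n) →ₗ[ℝ] EuclideanSpace ℝ (Fin n),
      (∀ g, Q g ∈ Hol x g) ∧ ∀ v, Tendsto (fun g ↦ Q g v) (𝓝 h) (𝓝 (P v)) := by
  obtain ⟨c, hc, S, hS⟩ := hP
  -- The same loop and chart subdivision serve for every metric `g`.
  choose Q hQ using fun g : Met n M ↦ exists_isParallel g S
  refine ⟨Q, fun g ↦ ⟨c, hc, S, hQ g⟩, fun v ↦ ?_⟩
  obtain ⟨s, hs, hs0, hs1⟩ := hS v
  choose s' hs' hz0 hz1 using fun g ↦ hQ g v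
  have := tendsto_isParallel h S hs hs' (fun g ↦ by rw [hz0, hs0])
  simp only [hz1, hs1] at this
  exact this

end ParallelTransport

/-! ### Compactness of `SO(n)` and limits along ultrafilters -/

/-- The defining equations are closed, and rows of unit length have entries in `[-1, 1]`. -/
theorem isCompact_specialOrthogonalGroup (n : ℕ) :
    IsCompact (Matrix.specialOrthogonalGroup (Fin n) ℝ : Set (Matrix (Fin n) (Fin n) ℝ)) := by
  have hbox : IsCompact (univ.pi fun _ : Fin n ↦ univ.pi fun _ : Fin n ↦ Icc (-1 : ℝ) 1) :=
    isCompact_univ_pi fun _ ↦ isCompact_univ_pi fun _ ↦ isCompact_Icc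
  have heq : (Matrix.specialOrthogonalGroup (Fin n) ℝ : Set (Matrix (Fin n) (Fin n) ℝ)) =
      {A | A * A.transpose = 1 ∧ A.det = 1} := by
    ext A
    exact (Matrix.mem_specialOrthogonalGroup_iff).trans
      (and_congr_left' (Matrix.mem_orthogonalGroup_iff _ _))
  rw [heq]
  refine hbox.of_isClosed_subset ?_ ?_
  · exact (isClosed_eq (continuous_id.matrix_mul continuous_id.matrix_transpose)
      continuous_const).inter (isClosed_eq continuous_id.matrix_det continuous_const)
  · rintro A ⟨hA, -⟩ i - j -
    have h1 : ∑ k, A i k * A i k = 1 := (congrFun₂ hA i i).trans (Matrix.one_apply_eq i)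
    have h2 : A i j * A i j ≤ 1 := h1 ▸ Finset.single_le_sum (f := fun k ↦ A i k * A i k)
      (fun k _ ↦ mul_self_nonneg _) (Finset.mem_univ j)
    exact abs_le.1 (abs_le_one_iff_mul_self_le_one.2 h2)

instance (n : ℕ) : CompactSpace (Matrix.specialOrthogonalGroup (Fin n) ℝ) :=
  isCompact_iff_compactSpace.1 (isCompact_specialOrthogonalGroup n)

theorem Ultrafilter.exists_tendsto_of_compactSpace {X Y : Type*} [TopologicalSpace Y]
    [CompactSpace Y] (F : Ultrafilter X) (f : X → Y) : ∃ y, Tendsto f F (𝓝 y) := by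
  obtain ⟨y, -, hy⟩ := isCompact_univ.ultrafilter_le_nhds' (F.map f) univ_mem
  exact ⟨y, hy⟩

/-! ### Orthonormal bases for a varying form -/

section Orthonormal

variable {E : Type*} [NormedAddCommGroup E] [NormedSpace ℝ E] {ι : Type*} [Fintype ι]
  [DecidableEq ι] {B : E →L[ℝ] E →L[ℝ] ℝ}

theorem linearIndependent_of_form {b : ι → E} (hb : ∀ i j, B (b i) (b j) = if i = j then 1 else 0) :
    LinearIndependent ℝ b := by
  rw [Fintype.linearIndependent_iff]
  intro c hc i
  have := congrArg (B (b i)) hc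
  simpa [hb] using this

theorem Module.Basis.repr_eq_form {b : Module.Basis ι ℝ E}
    (hb : ∀ i j, B (b i) (b j) = if i = j then 1 else 0) (v : E) (i : ι) :
    b.repr v i = B (b i) v := by
  have h : B (b i) (∑ j, b.repr v j • b j) = b.repr v i := by
    simp only [map_sum, map_smul, hb, smul_eq_mul, mul_ite, mul_one, mul_zero,
      Finset.sum_ite_eq, Finset.mem_univ, if_true]
  rw [← h, b.sum_repr]

/-- Writing the entries through the form avoids the dual basis and makes their continuity in form,
basis and map visible. -/
theorem toMatrix_eq_form {b : Module.Basis ι ℝ E}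
    (hb : ∀ i j, B (b i) (b j) = if i = j then 1 else 0) (P : E →ₗ[ℝ] E) :
    LinearMap.toMatrix b b P = Matrix.of fun i j ↦ B (b i) (P (b j)) := by
  ext i j
  rw [LinearMap.toMatrix_apply, Module.Basis.repr_eq_form hb, Matrix.of_apply]

theorem eventually_norm_sub_apply_le {F : Type*} [NormedAddCommGroup F] [NormedSpace ℝ F]
    (L : E →L[ℝ] F) {δ : ℝ} (hδ : 0 < δ) : ∀ᶠ A in 𝓝 L, ∀ v, ‖A v - L v‖ ≤ δ * ‖v‖ := by
  filter_upwards [Metric.ball_mem_nhds L hδ] with A hA v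
  rw [← sub_apply]
  exact (ContinuousLinearMap.le_opNorm _ v).trans
    (mul_le_mul_of_nonneg_right (mem_ball_iff_norm.1 hA).le (norm_nonneg v))

/-- The perturbation costs at most half of `‖v‖ ^ 2`, leaving `‖v‖ ^ 2 ≤ 2 * C`; the bound `2 * C +
1` avoids a square root. -/
theorem norm_le_of_form_close {B₀ : E →L[ℝ] E →L[ℝ] ℝ} {C : ℝ} (hC : 0 < C)
    (hB₀ : ∀ v, ‖v‖ ^ 2 ≤ C * B₀ v v) (hB : ∀ v, ‖B v - B₀ v‖ ≤ 1 / (2 * C) * ‖v‖) {v : E}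
    (hv : B v v = 1) : ‖v‖ ≤ 2 * C + 1 := by
  have h1 : B₀ v v - B v v ≤ 1 / (2 * C) * ‖v‖ * ‖v‖ := by
    have := (ContinuousLinearMap.le_opNorm (B v - B₀ v) v).trans
      (mul_le_mul_of_nonneg_right (hB v) (norm_nonneg v))
    rw [sub_apply, norm_sub_rev] at this
    exact (Real.le_norm_self _).trans this
  rw [hv] at h1
  have h2 : C * B₀ v v ≤ C * (1 + 1 / (2 * C) * ‖v‖ * ‖v‖) :=
    mul_le_mul_of_nonneg_left (by linarith) hC.le
  have h3 : C * (1 + 1 / (2 * C) * ‖v‖ * ‖v‖) = C + ‖v‖ ^ 2 / 2 := by field_simp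
  have h4 := hB₀ v
  nlinarith [sq_nonneg (‖v‖ - 1)]

theorem eventually_norm_le_of_tendsto_form {X : Type*} {l : Filter X} {B : X → E →L[ℝ] E →L[ℝ] ℝ}
    {B₀ : E →L[ℝ] E →L[ℝ] ℝ} {C : ℝ} (hC : 0 < C) (hB₀ : ∀ v, ‖v‖ ^ 2 ≤ C * B₀ v v)
    (hB : Tendsto B l (𝓝 B₀)) : ∀ᶠ x in l, ∀ v, B x v v = 1 → ‖v‖ ≤ 2 * C + 1 := by
  have hpos : 0 < 1 / (2 * C) := by positivity
  filter_upwards [hB.eventually (eventually_norm_sub_apply_le B₀ hpos)] with x hx v hv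
  exact norm_le_of_form_close hC hB₀ hx hv

theorem tendsto_form_apply {X : Type*} {l : Filter X} {B : X → E →L[ℝ] E →L[ℝ] ℝ}
    {B₀ : E →L[ℝ] E →L[ℝ] ℝ} (hB : Tendsto B l (𝓝 B₀)) {v w : X → E} {v₀ w₀ : E}
    (hv : Tendsto v l (𝓝 v₀)) (hw : Tendsto w l (𝓝 w₀)) :
    Tendsto (fun x ↦ B x (v x) (w x)) l (𝓝 (B₀ v₀ w₀)) := by
  have h1 : Continuous fun p : (E →L[ℝ] E →L[ℝ] ℝ) × E ↦ p.1 p.2 :=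
    continuous_fst.clm_apply continuous_snd
  have h2 : Continuous fun p : (E →L[ℝ] ℝ) × E ↦ p.1 p.2 :=
    continuous_fst.clm_apply continuous_snd
  exact (h2.tendsto (B₀ v₀, w₀)).comp
    (((h1.tendsto (B₀, v₀)).comp (hB.prodMk_nhds hv)).prodMk_nhds hw)

theorem Module.Basis.tendsto_det [FiniteDimensional ℝ E] {X : Type*} {l : Filter X}
    (b : Module.Basis ι ℝ E) {v : X → ι → E} (hv : ∀ i, Tendsto (fun x ↦ v x i) l (𝓝 (b i))) :
    Tendsto (fun x ↦ b.det (v x)) l (𝓝 1) := by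
  rw [← b.det_self]
  simp only [b.det_apply]
  refine (continuous_id.matrix_det.tendsto _).comp
    (tendsto_pi_nhds.2 fun i ↦ tendsto_pi_nhds.2 fun j ↦ ?_)
  exact ((b.coord i).continuous_of_finiteDimensional.tendsto _).comp (hv j)

/-- The condition that a set of linear maps is conjugate into a set of matrices, in the form that
passes to limits. -/
theorem conj_eq_iff {n : ℕ} {U : Matrix.specialOrthogonalGroup (Fin n) ℝ}
    {P A : Matrix (Fin n) (Fin n) ℝ} :
    (U : Matrix (Fin n) (Fin n) ℝ) * P *
        ((U⁻¹ : Matrix.specialOrthogonalGroup (Fin n) ℝ) : Matrix (Fin n) (Fin n) ℝ) = A ↔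
      (U : Matrix (Fin n) (Fin n) ℝ) * P = A * (U : Matrix (Fin n) (Fin n) ℝ) := by
  have h1 : ((U⁻¹ : Matrix.specialOrthogonalGroup (Fin n) ℝ) : Matrix (Fin n) (Fin n) ℝ) *
      (U : Matrix (Fin n) (Fin n) ℝ) = 1 := by
    rw [← Submonoid.coe_mul, inv_mul_cancel, Submonoid.coe_one]
  have h2 : (U : Matrix (Fin n) (Fin n) ℝ) *
      ((U⁻¹ : Matrix.specialOrthogonalGroup (Fin n) ℝ) : Matrix (Fin n) (Fin n) ℝ) = 1 := by
    rw [← Submonoid.coe_mul, mul_inv_cancel, Submonoid.coe_one]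
  constructor
  · rintro rfl
    rw [Matrix.mul_assoc, h1, Matrix.mul_one]
  · intro h
    rw [h, Matrix.mul_assoc, h2, Matrix.mul_one]

end Orthonormal

/-! ### Passage to the limit -/

section Limits

variable {n : ℕ} {M : Type*} [TopologicalSpace M] [ChartedSpace (EuclideanSpace ℝ (Fin n)) M]

theorem Met.eventually_norm_le [IsManifold (𝓡 n) 1 M] (h : Met n M) (p : M) :
    ∃ R : ℝ, ∀ᶠ g in 𝓝 h, ∀ v, (g : Met n M).form p v v = 1 → ‖v‖ ≤ R := by
  obtain ⟨C, hC, hv⟩ := h.exists_norm_sq_le_form p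
  exact ⟨2 * C + 1, eventually_norm_le_of_tendsto_form hC hv (h.tendsto_form p)⟩

/-- In finite dimension a linear map is governed by its values on a basis, so pointwise convergence
also allows the argument to vary. -/
theorem tendsto_apply_of_tendsto_pointwise {ι X : Type*} [Fintype ι] {l : Filter X}
    {Q : X → EuclideanSpace ℝ ι →ₗ[ℝ] EuclideanSpace ℝ ι}
    {P : EuclideanSpace ℝ ι →ₗ[ℝ] EuclideanSpace ℝ ι}
    (hQ : ∀ v, Tendsto (fun x ↦ Q x v) l (𝓝 (P v))) {v : X → EuclideanSpace ℝ ι}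
    {v₀ : EuclideanSpace ℝ ι} (hv : Tendsto v l (𝓝 v₀)) :
    Tendsto (fun x ↦ Q x (v x)) l (𝓝 (P v₀)) := by
  classical
  have hL (L : EuclideanSpace ℝ ι →ₗ[ℝ] EuclideanSpace ℝ ι) (w : EuclideanSpace ℝ ι) :
      L w = ∑ i, w i • L (EuclideanSpace.single i 1) := by
    conv_lhs => rw [← EuclideanSpace.sum_smul_single w]
    simp
  simp only [hL _ (v _), hL _ v₀]
  exact tendsto_finsetSum _ fun i _ ↦ Tendsto.smul
    (((EuclideanSpace.proj i : EuclideanSpace ℝ ι →L[ℝ] ℝ).continuous.tendsto _).comp hv) (hQ _)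

/-- `HolSubsetUpToConj` with the tangent space unfolded to the model space. -/
theorem holSubsetUpToConj_iff (o : ManifoldOrientation n M)
    (H : Subgroup (Matrix.specialOrthogonalGroup (Fin n) ℝ)) (x : M) (h : Met n M) :
    HolSubsetUpToConj o H x h ↔ ∃ b : Module.Basis (Fin n) ℝ (EuclideanSpace ℝ (Fin n)),
      b.orientation = o.at_ x ∧ (∀ i j, h.form x (b i) (b j) = if i = j then 1 else 0) ∧
      ∃ U : Matrix.specialOrthogonalGroup (Fin n) ℝ,
        ∀ P : EuclideanSpace ℝ (Fin n) →ₗ[ℝ] EuclideanSpace ℝ (Fin n), P ∈ Hol x h → ∃ A ∈ H,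
          (U : Matrix (Fin n) (Fin n) ℝ) * (Matrix.of fun i j ↦ h.form x (b i) (P (b j))) =
            (A : Matrix (Fin n) (Fin n) ℝ) * (U : Matrix (Fin n) (Fin n) ℝ) := by
  refine exists_congr fun b ↦ and_congr_right fun _ ↦ and_congr_right fun hb ↦
    exists_congr fun U ↦ forall₂_congr fun P _ ↦ exists_congr fun A ↦ and_congr_right fun _ ↦ ?_
  rw [conj_eq_iff]
  have h2 : LinearMap.toMatrix b b P = Matrix.of fun i j ↦ h.form x (b i) (P (b j)) :=
    toMatrix_eq_form (E := EuclideanSpace ℝ (Fin n)) (B := h.form x) hb P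
  rw [h2]
  rfl

end Limits

end

theorem corollary3p3 {n : ℕ} {M : Type*} [TopologicalSpace M]
    [ChartedSpace (EuclideanSpace ℝ (Fin n)) M] [IsManifold (𝓡 n) 1 M]
    (o : ManifoldOrientation n M)
    (H : Subgroup (Matrix.specialOrthogonalGroup (Fin n) ℝ))
    (hH : IsClosed (H : Set (Matrix.specialOrthogonalGroup (Fin n) ℝ))) (x : M) :
    IsClosed {h : Met n M | HolSubsetUpToConj o H x h} := by
  -- Along an ultrafilter all limits in compact sets exist at once, so no subnets are chosen.
  rw [isClosed_iff_ultrafilter]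
  intro h F hF hS
  have hex : ∀ g : Met n M, ∃ (b : Module.Basis (Fin n) ℝ (EuclideanSpace ℝ (Fin n)))
      (U : Matrix.specialOrthogonalGroup (Fin n) ℝ), HolSubsetUpToConj o H x g →
      b.orientation = o.at_ x ∧ (∀ i j, g.form x (b i) (b j) = if i = j then 1 else 0) ∧
      ∀ P : EuclideanSpace ℝ (Fin n) →ₗ[ℝ] EuclideanSpace ℝ (Fin n), P ∈ Hol x g → ∃ A ∈ H,
          (U : Matrix (Fin n) (Fin n) ℝ) * (Matrix.of fun i j ↦ g.form x (b i) (P (b j))) =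
            (A : Matrix (Fin n) (Fin n) ℝ) * (U : Matrix (Fin n) (Fin n) ℝ) := fun g ↦ by
    by_cases hg : HolSubsetUpToConj o H x g
    · obtain ⟨b, hb, hb', U, hU⟩ := (holSubsetUpToConj_iff o H x g).1 hg
      exact ⟨b, U, fun _ ↦ ⟨hb, hb', hU⟩⟩
    -- Arbitrary values off the set, which has full measure for `F`; they only make the choice
    -- total.
    · exact ⟨(EuclideanSpace.basisFun (Fin n) ℝ).toBasis, 1, fun hg' ↦ absurd hg' hg⟩
  choose b U hbU using hex
  have hev : ∀ᶠ g in (F : Filter (Met n M)), HolSubsetUpToConj o H x g := hS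
  obtain ⟨U₀, hU₀⟩ := F.exists_tendsto_of_compactSpace U
  obtain ⟨b₀, hb₀⟩ : ∃ b₀ : Fin n → EuclideanSpace ℝ (Fin n),
      Tendsto (fun g i ↦ b g i) F (𝓝 b₀) := by
    obtain ⟨R, hR⟩ := h.eventually_norm_le x
    have hK : IsCompact (univ.pi fun _ : Fin n ↦
        Metric.closedBall (0 : EuclideanSpace ℝ (Fin n)) R) :=
      isCompact_univ_pi fun _ ↦ isCompact_closedBall _ _
    obtain ⟨b₀, -, hb₀⟩ := hK.ultrafilter_le_nhds' (F.map fun g i ↦ b g i) (by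
      rw [Ultrafilter.mem_map]
      change ∀ᶠ g in (F : Filter (Met n M)), _
      filter_upwards [hF hR, hev] with g hg hg' i _
      rw [mem_closedBall_zero_iff]
      exact hg _ (by simp [(hbU g hg').2.1]))
    exact ⟨b₀, hb₀⟩
  have hbi (i : Fin n) : Tendsto (fun g ↦ b g i) F (𝓝 (b₀ i)) := tendsto_pi_nhds.1 hb₀ i
  have hform : Tendsto (fun g : Met n M ↦ g.form x) F (𝓝 (h.form x)) :=
    (h.tendsto_form x).mono_left hF
  have hform₂ {v w : Met n M → EuclideanSpace ℝ (Fin n)} {v₀ w₀ : EuclideanSpace ℝ (Fin n)}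
      (hv : Tendsto v F (𝓝 v₀)) (hw : Tendsto w F (𝓝 w₀)) :
      Tendsto (fun g : Met n M ↦ g.form x (v g) (w g)) F (𝓝 (h.form x v₀ w₀)) :=
    tendsto_form_apply hform hv hw
  have horth : ∀ i j, h.form x (b₀ i) (b₀ j) = if i = j then 1 else 0 := fun i j ↦
    tendsto_nhds_unique (hform₂ (hbi i) (hbi j)) (tendsto_const_nhds.congr' (by
      filter_upwards [hev] with g hg
      exact ((hbU g hg).2.1 i j).symm))
  set β := basisOfLinearIndependentOfCardEqFinrank' b₀ (linearIndependent_of_form horth)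
    (by simp) with hβ
  have hββ : ⇑β = b₀ := coe_basisOfLinearIndependentOfCardEqFinrank' _ _ _
  refine (holSubsetUpToConj_iff o H x h).2 ⟨β, ?_, by simpa only [hββ] using horth, U₀,
    fun P hP ↦ ?_⟩
  -- The determinant of `b g` relative to the limit basis tends to 1, so some `b g` from the set has
  -- the orientation of `β`.
  · have hdet : Tendsto (fun g ↦ β.det (b g)) F (𝓝 1) :=
      β.tendsto_det fun i ↦ by rw [hββ]; exact hbi i
    obtain ⟨g, hg, hg'⟩ := (hev.and (hdet.eventually (lt_mem_nhds one_pos))).exists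
    rw [← (hbU g hg).1]
    exact (β.orientation_eq_iff_det_pos (b g)).2 hg'
  · obtain ⟨Q, hQ, hQP⟩ := exists_tendsto_of_mem_Hol h hP
    have hexA : ∀ g : Met n M, ∃ A : Matrix.specialOrthogonalGroup (Fin n) ℝ,
        HolSubsetUpToConj o H x g → A ∈ H ∧
          (U g : Matrix (Fin n) (Fin n) ℝ) *
            (Matrix.of fun i j ↦ g.form x (b g i) (Q g (b g j))) =
            (A : Matrix (Fin n) (Fin n) ℝ) * (U g : Matrix (Fin n) (Fin n) ℝ) := fun g ↦ by
      by_cases hg : HolSubsetUpToConj o H x g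
      · obtain ⟨A, hA⟩ := (hbU g hg).2.2 (Q g) (hQ g)
        exact ⟨A, fun _ ↦ hA⟩
      · exact ⟨1, fun hg' ↦ absurd hg' hg⟩
    choose A hA using hexA
    -- Only `A₀` may depend on `P`; the basis `β` and `U₀` were fixed before `P`.
    obtain ⟨A₀, hA₀⟩ := F.exists_tendsto_of_compactSpace A
    refine ⟨A₀, hH.mem_of_tendsto hA₀ (by
      filter_upwards [hev] with g hg
      exact (hA g hg).1), ?_⟩
    have hmat : Tendsto (fun g : Met n M ↦ Matrix.of fun i j ↦ g.form x (b g i) (Q g (b g j))) F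
        (𝓝 (Matrix.of fun i j ↦ h.form x (β i) (P (β j)))) :=
      tendsto_pi_nhds.2 fun i ↦ tendsto_pi_nhds.2 fun j ↦ by
        rw [hββ]
        exact hform₂ (hbi i) (tendsto_apply_of_tendsto_pointwise
          (fun v ↦ (hQP v).mono_left hF) (hbi j))
    have hUc := (continuous_subtype_val.tendsto U₀).comp hU₀
    have hAc := (continuous_subtype_val.tendsto A₀).comp hA₀
    refine tendsto_nhds_unique (hUc.mul hmat) ((hAc.mul hUc).congr' ?_)
    filter_upwards [hev] with g hg
    exact (hA g hg).2.symm
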